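/- For finite graphs $H, G$ let $p(H,G)$ be the probability that a uniformly random set of $|V(H)|$ vertices of $G$ induces a subgraph isomorphic to $H$. A graph sequence is a sequence $\mathcal G=(G_n)$ of finite simple graphs with $|V(G_n)|\to\infty$; put $\overline p(H,\mathcal G)=\limsup_n p(H,G_n)$ and $\underline p(H,\mathcal G)=\liminf_n p(H,G_n)$. Call $\mathcal G$ $3$-universal if $\underline p(H,\mathcal G)>0$ for every $3$-vertex graph $H$. Let $\theta$ be the largest real root of $\theta^3+\theta^2-\theta+\frac16=0$ and $\rho=6\theta^2(1-2\theta)$. Then $\theta\approx 0.427373$ (rounded to six decimals), $\rho=0.159181\ldots$, and every graph sequence $\mathcal G$ with $\overline p(\overline{K}_3,\mathcal G)<\rho$ and $\overline p(K_3,\mathcal G)<\rho$ is $3$-universal. The bound is tight: there is a graph sequence $\mathcal G$ with $\overline p(\overline{K}_3,\mathcal G)=\overline p(K_3,\mathcal G)=\rho$ that is not $3$-universal (so $\rho$ cannot be replaced by any larger constant, nor the strict inequalities by non-strict ones). -/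

import Mathlib

open Filter Topology

universe u

/-- `inducedDensity H G` is `p(H, G)`: the probability that a uniformly random set of `|V(H)|`
vertices of the finite graph `G` induces a subgraph isomorphic to `H`. (If `G` has fewer vertices
than `H`, the value is `0 / 0 = 0`; this concerns only finitely many terms of a graph sequence.) -/
noncomputable def inducedDensity {W V : Type*} [Fintype W] [Fintype V]
    (H : SimpleGraph W) (G : SimpleGraph V) : ℝ := by
  classical
  exact (((Finset.univ : Finset V).powersetCard (Fintype.card W)).filter
      (fun s : Finset V => Nonempty (H ≃g G.induce (s : Set V)))).card /
    ((Fintype.card V).choose (Fintype.card W) : ℝ)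

/-- A sequence of finite graphs whose numbers of vertices tend to infinity. -/
structure GraphSeq where
  /-- the vertex sets -/
  V : ℕ → Type u
  /-- the vertex sets are finite -/
  [fintypeV : ∀ n, Fintype (V n)]
  /-- the graphs -/
  graph : ∀ n, SimpleGraph (V n)
  tendsto_card : Tendsto (fun n => Fintype.card (V n)) atTop atTop

attribute [instance] GraphSeq.fintypeV

namespace GraphSeq

/-- The upper density `limsup p(H, Gₙ)` of `H` in a graph sequence. -/
noncomputable def upperDensity {W : Type*} [Fintype W] (H : SimpleGraph W)
    (𝒢 : GraphSeq.{u}) : ℝ :=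
  limsup (fun n => inducedDensity H (𝒢.graph n)) atTop

/-- The lower density `liminf p(H, Gₙ)` of `H` in a graph sequence. -/
noncomputable def lowerDensity {W : Type*} [Fintype W] (H : SimpleGraph W)
    (𝒢 : GraphSeq.{u}) : ℝ :=
  liminf (fun n => inducedDensity H (𝒢.graph n)) atTop

/-- A graph sequence is `l`-universal if every graph on `l` vertices has positive lower density. -/
def IsUniversal (l : ℕ) (𝒢 : GraphSeq.{u}) : Prop :=
  ∀ H : SimpleGraph (Fin l), 0 < lowerDensity H 𝒢

end GraphSeq

/-!
If a 3-vertex graph `H` has vanishing density along a subsequence, then either `H` is complete or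
empty, or `H` or its complement is the cherry (the path on three vertices). In the first case
Goodman's bound (`expect_cliqueWeight_add_anticliqueWeight`) makes the densities of `K₃` and its
complement sum to at least `1 / 4 - o(1)`, so one of them exceeds `ρ < 0.16`. By passing to
complements, the remaining case is that of graphs `G` with few cherries.

A cherry-free graph is a disjoint union of cliques. If the cliques take up the fractions `x i` of
the vertices, the densities of `K₃` and its complement are, up to `o(1)`, `∑ x i ^ 3` and
`1 - 3 * ∑ x i ^ 2 + 2 * ∑ x i ^ 3` (which is six times the third elementary symmetric function).
The larger of the two is at least `ρ` (`le_max_sum_pow_of_mem_stdSimplex`): at a minimiser, any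
three parts `a > b ≥ c > 0` could be replaced by parts with the same sum and the same sum of squares
but a smaller sum of cubes (`exists_sum_cube_lt`), which would lower both quantities; so the
minimiser is essentially of the form `(t, t, 1 - 2t)`, and the optimal `t` is `θ`.

No removal lemma is needed to pass from few cherries to none. Restrict `G` to a random map from a
set of `m` points. If the density of cherries is small compared with `m⁻³`, the sample is very
likely cherry-free, hence an exact disjoint union of cliques, and by the second moment method
(`expect_sample_sub_sq_le`) its densities of triangles and of empty triples differ from those of `G`
by `O(m ^ (-1/2))` (`exists_sample_cherryFree`). To make the identities for samples exact, a point
is counted as adjacent to itself (`closedAdj`); repetitions in the sample are then harmless.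

The bound is attained by disjoint unions of three cliques with vertex fractions `θ`, `θ`, `1 - 2θ`,
which contain no cherry at all (`extremalSeq`).
-/

open scoped BigOperators

/-! ### The extremal inequality for cluster sizes -/

/-- The cubic changes sign on the interval, and it is increasing to the right of `1 / 3`. -/
theorem cubic_root_isGreatest :
    ∃ θ : ℝ, IsGreatest {x : ℝ | x ^ 3 + x ^ 2 - x + 1 / 6 = 0} θ ∧
      0.4273725 < θ ∧ θ < 0.4273735 := by
  have hc : ContinuousOn (fun x : ℝ => x ^ 3 + x ^ 2 - x + 1 / 6) (Set.Icc 0.4273725 0.4273735) := by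
    fun_prop
  obtain ⟨θ, ⟨h1, h2⟩, h3⟩ := intermediate_value_Ioo (by norm_num) hc
    (show (0 : ℝ) ∈ Set.Ioo _ _ by constructor <;> norm_num)
  refine ⟨θ, ⟨h3, fun x hx => ?_⟩, h1, h2⟩
  by_contra! hlt
  simp only [Set.mem_ofPred_eq] at hx h3
  have : (x - θ) * (x ^ 2 + x * θ + θ ^ 2 + x + θ - 1) = 0 := by linear_combination hx - h3
  have h4 : 0 < x ^ 2 + x * θ + θ ^ 2 + x + θ - 1 := by nlinarith
  rcases mul_eq_zero.1 this with h | h <;> linarith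

/-- The largest of three numbers is lowered by a small `u`; the other two become the roots of a
quadratic that keeps the sum and the sum of squares. Then the sum of cubes changes by three times
the change of the product, whose derivative at `u = 0` is `-(a - b) * (a - c) < 0`. -/
theorem exists_sum_cube_lt {a b c : ℝ} (hc : 0 < c) (hcb : c ≤ b) (hba : b < a) :
    ∃ a' b' c' : ℝ, 0 ≤ a' ∧ 0 ≤ b' ∧ 0 ≤ c' ∧ a' + b' + c' = a + b + c ∧
      a' ^ 2 + b' ^ 2 + c' ^ 2 = a ^ 2 + b ^ 2 + c ^ 2 ∧
      a' ^ 3 + b' ^ 3 + c' ^ 3 < a ^ 3 + b ^ 3 + c ^ 3 := by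
  have hb : 0 < b := hc.trans_le hcb
  have ha : 0 < a := hb.trans hba
  have hD : 0 < (a - b) * (a - c) := mul_pos (by linarith) (by linarith)
  obtain ⟨u, hu, hu1, hu2, hu3, hu4⟩ : ∃ u : ℝ, 0 < u ∧ u ≤ b * c / a ∧
      u ≤ (a - b) * (a - c) / (3 * a) ∧ u ≤ a - b ∧ u ≤ a :=
    ⟨min (min (b * c / a) ((a - b) * (a - c) / (3 * a))) (min (a - b) a),
      lt_min (lt_min (by positivity) (by positivity)) (lt_min (by linarith) ha),
      (min_le_left _ _).trans (min_le_left _ _), (min_le_left _ _).trans (min_le_right _ _),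
      (min_le_right _ _).trans (min_le_left _ _), (min_le_right _ _).trans (min_le_right _ _)⟩
  rw [le_div_iff₀ ha] at hu1
  rw [le_div_iff₀ (by positivity)] at hu2
  set M := b + c + u with hM
  set N := b * c - u * (a - b - c) + u ^ 2 with hN
  have hN0 : 0 ≤ N := by nlinarith [mul_pos hu hb, mul_pos hu hc, sq_nonneg u]
  have hdisc : 0 ≤ M ^ 2 - 4 * N := by
    have : M ^ 2 - 4 * N = (b - c) ^ 2 + u * (4 * a - 2 * (b + c) - 3 * u) := by rw [hM, hN]; ring
    rw [this]
    exact add_nonneg (sq_nonneg _) (mul_nonneg hu.le (by linarith))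
  set r := √(M ^ 2 - 4 * N) with hr
  have hr2 : r ^ 2 = M ^ 2 - 4 * N := Real.sq_sqrt hdisc
  have hr0 : 0 ≤ r := Real.sqrt_nonneg _
  have hM0 : 0 < M := by positivity
  have hrM : r ≤ M := abs_le_of_sq_le_sq' (by linarith) hM0.le |>.2
  refine ⟨a - u, (M + r) / 2, (M - r) / 2, by linarith, by linarith, by linarith, by linarith,
    ?_, ?_⟩
  · have : (a - u) ^ 2 + ((M + r) / 2) ^ 2 + ((M - r) / 2) ^ 2 = (a - u) ^ 2 + M ^ 2 - 2 * N := by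
      linear_combination hr2 / 2
    rw [this, hM, hN]; ring
  · have : (a - u) ^ 3 + ((M + r) / 2) ^ 3 + ((M - r) / 2) ^ 3 = (a - u) ^ 3 + M ^ 3 - 3 * M * N := by
      linear_combination 3 * M / 4 * hr2
    have h2 : (a - u) ^ 3 + M ^ 3 - 3 * M * N - (a ^ 3 + b ^ 3 + c ^ 3)
        = -3 * u * ((a - b) * (a - c) - u * (2 * a - b - c) + u ^ 2) := by rw [hM, hN]; ring
    have h3 : 0 < (a - b) * (a - c) - u * (2 * a - b - c) + u ^ 2 := by
      nlinarith [mul_pos hu hb, mul_pos hu hc, mul_pos hu ha]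
    nlinarith [mul_pos hu h3]

/-- A sum with at most one nonzero term commutes with powers. -/
theorem sum_pow_eq_pow_sum_of_subsingleton {ι : Type*} (S : Finset ι) (x : ι → ℝ)
    (h : ∀ k ∈ S, ∀ l ∈ S, k ≠ l → x k = 0 ∨ x l = 0) {p : ℕ} (hp : p ≠ 0) :
    ∑ k ∈ S, x k ^ p = (∑ k ∈ S, x k) ^ p := by
  classical
  by_cases h0 : ∃ k ∈ S, x k ≠ 0
  · obtain ⟨k, hk, hk0⟩ := h0
    have hl : ∀ l ∈ S, l ≠ k → x l = 0 := fun l hl hlk => (h k hk l hl hlk.symm).resolve_left hk0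
    rw [Finset.sum_eq_single_of_mem k hk hl,
      Finset.sum_eq_single_of_mem k hk fun l hlS hlk => by rw [hl l hlS hlk, zero_pow hp]]
  · push Not at h0
    rw [Finset.sum_eq_zero h0, Finset.sum_eq_zero fun k hk => by rw [h0 k hk, zero_pow hp],
      zero_pow hp]

theorem sum_comp_update {ι : Type*} [Fintype ι] [DecidableEq ι] (φ : ℝ → ℝ) (y : ι → ℝ) (i : ι)
    (a : ℝ) : ∑ l, φ (Function.update y i a l) = ∑ l, φ (y l) - φ (y i) + φ a := by
  rw [← Finset.add_sum_erase _ _ (Finset.mem_univ i),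
    ← Finset.add_sum_erase _ (fun l => φ (y l)) (Finset.mem_univ i), Function.update_self,
    Finset.sum_congr rfl fun l hl => by rw [Function.update_of_ne (Finset.ne_of_mem_erase hl)]]
  ring

/-- The extremal inequality for the parts `t, t, 1 - 2t`: the sum of cubes increases with `t`, the
other quantity decreases, and they agree at `t = θ`. -/
theorem le_max_two_equal_parts {θ t : ℝ} (hθ : θ ^ 3 + θ ^ 2 - θ + 1 / 6 = 0)
    (h1 : 0.4273725 < θ) (ht : 1 / 3 ≤ t) (ht' : t ≤ 1 / 2) :
    6 * θ ^ 2 * (1 - 2 * θ) ≤ max (2 * t ^ 3 + (1 - 2 * t) ^ 3) (6 * t ^ 2 * (1 - 2 * t)) := by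
  rcases le_total θ t with h | h
  · refine le_max_of_le_left ?_
    have e : 6 * θ ^ 2 * (1 - 2 * θ) = 2 * θ ^ 3 + (1 - 2 * θ) ^ 3 := by linear_combination (-6) * hθ
    rw [e]
    nlinarith [mul_nonneg (sub_nonneg.2 h) (sub_nonneg.2 ht), 
      mul_nonneg (sub_nonneg.2 h) (sub_nonneg.2 ht'),
      mul_nonneg (mul_nonneg (sub_nonneg.2 h) (sub_nonneg.2 ht)) (sub_nonneg.2 ht')]
  · refine le_max_of_le_right ?_
    nlinarith [mul_nonneg (sub_nonneg.2 h) (sub_nonneg.2 ht), 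
      mul_nonneg (sub_nonneg.2 h) (sub_nonneg.2 ht'),
      mul_nonneg (mul_nonneg (sub_nonneg.2 h) (sub_nonneg.2 ht)) (sub_nonneg.2 ht)]

/-- The extremal inequality: in a disjoint union of cliques with vertex fractions `x i`, the larger
of the limiting densities of `K₃` and of its complement is at least `ρ = 6 θ² (1 - 2θ)`. -/
theorem le_max_sum_pow_of_mem_stdSimplex {ι : Type*} [Fintype ι] {θ : ℝ}
    (hθ : θ ^ 3 + θ ^ 2 - θ + 1 / 6 = 0) (h1 : 0.4273725 < θ) (h2 : θ < 0.4273735)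
    {x : ι → ℝ} (hx : x ∈ stdSimplex ℝ ι) :
    6 * θ ^ 2 * (1 - 2 * θ) ≤ max (∑ i, x i ^ 3) (1 - 3 * ∑ i, x i ^ 2 + 2 * ∑ i, x i ^ 3) := by
  classical
  set ρ := 6 * θ ^ 2 * (1 - 2 * θ) with hρ
  have hρ' : ρ < 0.16 := by rw [hρ]; nlinarith
  set F : (ι → ℝ) → ℝ := fun x => max (∑ i, x i ^ 3) (1 - 3 * ∑ i, x i ^ 2 + 2 * ∑ i, x i ^ 3) with hF
  have hFc : Continuous F := by fun_prop
  obtain ⟨y, hy, hmin⟩ := (isCompact_stdSimplex ℝ ι).exists_isMinOn ⟨x, hx⟩ hFc.continuousOn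
  suffices hs : ρ ≤ F y from hs.trans (hmin hx)
  obtain ⟨hy0, hy1⟩ := hy
  by_contra! hlt
  have hs3 : ∑ i, y i ^ 3 < ρ := (le_max_left _ _).trans_lt hlt
  have hs0 : 1 - 3 * ∑ i, y i ^ 2 + 2 * ∑ i, y i ^ 3 < ρ := (le_max_right _ _).trans_lt hlt
  -- At a minimiser, the larger two of any three positive parts are equal.
  have hT : ∀ i j k, i ≠ j → i ≠ k → j ≠ k → 0 < y k → y k ≤ y j → y i ≤ y j := by
    intro i j k hij hik hjk hk hkj
    by_contra! hji
    obtain ⟨a, b, c, ha, hb, hc, e1, e2, e3⟩ := exists_sum_cube_lt hk hkj hji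
    set z := Function.update (Function.update (Function.update y i a) j b) k c with hz
    have hsum : ∀ φ : ℝ → ℝ, ∑ l, φ (z l)
        = ∑ l, φ (y l) + (φ a + φ b + φ c) - (φ (y i) + φ (y j) + φ (y k)) := by
      intro φ
      rw [hz, sum_comp_update, sum_comp_update, sum_comp_update, Function.update_of_ne hjk.symm,
        Function.update_of_ne hik.symm, Function.update_of_ne hij.symm]
      ring
    have z1 := hsum fun t => t
    have z2 := hsum fun t => t ^ 2
    have z3 := hsum fun t => t ^ 3
    have hzS : z ∈ stdSimplex ℝ ι := by
      refine ⟨fun l => ?_, by rw [z1, hy1]; linarith⟩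
      rw [hz]
      simp only [Function.update_apply]
      split_ifs
      exacts [hc, hb, ha, hy0 l]
    have hle : F y ≤ F z := hmin hzS
    have : F z < F y := max_lt_max (by linarith) (by linarith)
    linarith
  have hne : Nonempty ι := by
    by_contra h
    rw [not_nonempty_iff] at h
    simp at hy1
  obtain ⟨i, hi⟩ := Finite.exists_max y
  have hpos : ∀ k, y k ≠ 0 → 0 < y k := fun k hk => lt_of_le_of_ne (hy0 k) hk.symm
  -- If all parts are at most `1 / 3`, the second quantity is at least
  -- `(1 - s) * (1 - 2 * s) ≥ 2 / 9`, where `s` is the sum of squares.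
  have h13 : 1 / 3 < y i := by
    by_contra! ht
    have hs2 : ∑ l, y l ^ 2 ≤ 1 / 3 := by
      calc ∑ l, y l ^ 2 ≤ ∑ l, 1 / 3 * y l := Finset.sum_le_sum fun l _ => by
              nlinarith [hy0 l, hi l]
        _ = 1 / 3 := by rw [← Finset.mul_sum, hy1]; norm_num
    have hcs : (∑ l, y l ^ 2) ^ 2 ≤ (∑ l, y l) * ∑ l, y l ^ 3 :=
      Finset.sum_sq_le_sum_mul_sum_of_sq_le_mul _ (fun l _ => hy0 l)
        (fun l _ => pow_nonneg (hy0 l) 3) fun l _ => le_of_eq (by ring)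
    rw [hy1] at hcs
    nlinarith
  have hother : ∀ k l, k ≠ i → l ≠ i → k ≠ l → 0 < y k → 0 < y l → y k = y i ∨ y l = y i := by
    intro k l hk hl hkl hk0 hl0
    rcases le_total (y k) (y l) with h | h
    · exact .inr (le_antisymm (hi l) (hT i l k hl.symm hk.symm hkl.symm hk0 h))
    · exact .inl (le_antisymm (hi k) (hT i k l hk.symm hl.symm hkl hl0 h))
  have hsplit : ∀ p : ℕ, ∑ l, y l ^ p = y i ^ p + ∑ l ∈ Finset.univ.erase i, y l ^ p := fun p =>
    (Finset.add_sum_erase _ _ (Finset.mem_univ i)).symm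
  -- Either two parts equal the largest one, and at most one further part is positive, or the
  -- parts are `t, 1 - t`, with sum of cubes at least `1 / 4`.
  by_cases hj : ∃ j ≠ i, y j = y i
  · obtain ⟨j, hji, hj⟩ := hj
    have hsplit' : ∀ p : ℕ, ∑ l, y l ^ p
        = 2 * y i ^ p + ∑ l ∈ (Finset.univ.erase i).erase j, y l ^ p := fun p => by
      rw [hsplit, ← Finset.add_sum_erase (Finset.univ.erase i) _ (a := j) (by simp [hji]), hj]
      ring
    have hrest : ∑ l ∈ (Finset.univ.erase i).erase j, y l = 1 - 2 * y i := by
      have := hsplit' 1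
      simp only [pow_one, hy1] at this
      linarith
    have hsub : ∀ k ∈ (Finset.univ.erase i).erase j, ∀ l ∈ (Finset.univ.erase i).erase j,
        k ≠ l → y k = 0 ∨ y l = 0 := by
      have key : ∀ k ∈ (Finset.univ.erase i).erase j, y k < y i := fun k hk => by
        have := Finset.single_le_sum (f := y) (fun l _ => hy0 l) hk
        linarith
      intro k hk l hl hkl
      by_contra! h
      have hk' := key k hk
      have hl' := key l hl
      simp only [Finset.mem_erase, Finset.mem_univ, and_true] at hk hl
      rcases hother k l hk.2 hl.2 hkl (hpos k h.1) (hpos l h.2) with h | h <;> linarith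
    have hrest0 : 0 ≤ 1 - 2 * y i := hrest ▸ Finset.sum_nonneg fun l _ => hy0 l
    have e2 := hsplit' 2
    have e3 := hsplit' 3
    rw [sum_pow_eq_pow_sum_of_subsingleton _ _ hsub (by norm_num), hrest] at e2 e3
    have hm := le_max_two_equal_parts hθ h1 h13.le (by linarith : y i ≤ 1 / 2)
    rw [← hρ] at hm
    rcases le_max_iff.1 hm with h | h
    · linarith
    · have : 1 - 3 * ∑ l, y l ^ 2 + 2 * ∑ l, y l ^ 3 = 6 * y i ^ 2 * (1 - 2 * y i) := by
        rw [e2, e3]; ring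
      linarith
  · push Not at hj
    have hsub : ∀ k ∈ Finset.univ.erase i, ∀ l ∈ Finset.univ.erase i,
        k ≠ l → y k = 0 ∨ y l = 0 := by
      intro k hk l hl hkl
      by_contra! h
      simp only [Finset.mem_erase, Finset.mem_univ, and_true] at hk hl
      rcases hother k l hk hl hkl (hpos k h.1) (hpos l h.2) with h | h
      exacts [hj k hk h, hj l hl h]
    have hrest : ∑ l ∈ Finset.univ.erase i, y l = 1 - y i := by
      have := hsplit 1
      simp only [pow_one, hy1] at this
      linarith
    have e3 := hsplit 3
    rw [sum_pow_eq_pow_sum_of_subsingleton _ _ hsub (by norm_num), hrest] at e3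
    nlinarith [sq_nonneg (2 * y i - 1)]

/-! ### Averages over random maps -/

/-- Distinct coordinates of a uniformly random map are uniform and independent. -/
theorem expect_comp_injective {α β V : Type*} [Fintype α] [Fintype β] [DecidableEq α]
    [DecidableEq β] [Fintype V] [Nonempty V] {e : α → β} (he : Function.Injective e)
    (g : (α → V) → ℝ) : 𝔼 f : β → V, g (f ∘ e) = 𝔼 h : α → V, g h := by
  classical
  let e' := Equiv.ofInjective e he
  calc 𝔼 f : β → V, g (f ∘ e)
      = 𝔼 p : ({x // x ∈ Set.range e} → V) × ({x // ¬ x ∈ Set.range e} → V), g (p.1 ∘ e') :=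
        Fintype.expect_equiv (Equiv.piEquivPiSubtypeProd (· ∈ Set.range e) fun _ => V) _ _
          fun f => rfl
    _ = 𝔼 k : {x // x ∈ Set.range e} → V, g (k ∘ e') := by
        rw [← Finset.univ_product_univ, Finset.expect_product]
        simp
    _ = 𝔼 h : α → V, g h :=
        Fintype.expect_equiv (e'.arrowCongr (Equiv.refl V)).symm _ _ fun f => rfl

theorem expect_fin_three {V : Type*} [Fintype V] (g : (Fin 3 → V) → ℝ) :
    𝔼 h : Fin 3 → V, g h = 𝔼 x, 𝔼 y, 𝔼 z, g ![x, y, z] := by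
  let e : (Fin 3 → V) ≃ V × V × V :=
    { toFun := fun h => (h 0, h 1, h 2)
      invFun := fun p => ![p.1, p.2.1, p.2.2]
      left_inv := fun h => by ext i; fin_cases i <;> rfl
      right_inv := fun p => rfl }
  rw [Fintype.expect_equiv e g (fun p => g (e.symm p)) fun h => by rw [e.symm_apply_apply],
    ← Finset.univ_product_univ, Finset.expect_product]
  refine Finset.expect_congr rfl fun x _ => ?_
  rw [← Finset.univ_product_univ, Finset.expect_product]
  rfl

theorem expect_fin_two {V : Type*} [Fintype V] (φ : V → V → ℝ) :
    𝔼 h : Fin 2 → V, φ (h 0) (h 1) = 𝔼 x, 𝔼 y, φ x y := by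
  rw [Fintype.expect_equiv (finTwoArrowEquiv V) (fun h => φ (h 0) (h 1))
    (fun p : V × V => φ p.1 p.2) fun h => rfl, ← Finset.univ_product_univ, Finset.expect_product]

theorem expect_sum_arrow {κ V : Type*} [Fintype κ] [DecidableEq κ] [Fintype V]
    (φ : (κ → V) → (κ → V) → ℝ) :
    𝔼 h : κ ⊕ κ → V, φ (h ∘ Sum.inl) (h ∘ Sum.inr) = 𝔼 x, 𝔼 y, φ x y := by
  rw [Fintype.expect_equiv (Equiv.sumArrowEquivProdArrow κ κ V)
    (fun h => φ (h ∘ Sum.inl) (h ∘ Sum.inr))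
    (fun p : (κ → V) × (κ → V) => φ p.1 p.2) fun h => rfl, ← Finset.univ_product_univ,
    Finset.expect_product]

/-- Birthday bound: a random map fails to be injective with probability at most `|κ|² / |U|`. -/
theorem expect_not_injective_le {κ U : Type*} [Fintype κ] [DecidableEq κ] [Fintype U] [Nonempty U]
    [DecidablePred (Function.Injective : (κ → U) → Prop)] :
    𝔼 e : κ → U, (if Function.Injective e then (0 : ℝ) else 1)
      ≤ (Fintype.card κ : ℝ) ^ 2 / Fintype.card U := by
  classical
  have hpair : ∀ i j : κ, i ≠ j →
      𝔼 e : κ → U, (if e i = e j then (1 : ℝ) else 0) = 1 / Fintype.card U := by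
    intro i j hij
    have hinj : Function.Injective ![i, j] := by
      intro a b; fin_cases a <;> fin_cases b <;> simp [hij, hij.symm]
    have := expect_comp_injective (V := U) hinj fun h => if h 0 = h 1 then (1 : ℝ) else 0
    simp only [Function.comp_apply, Matrix.cons_val_zero, Matrix.cons_val_one] at this
    refine this.trans ?_
    rw [expect_fin_two fun x y => if x = y then (1 : ℝ) else 0]
    simp [Finset.expect_ite_eq]
  calc 𝔼 e : κ → U, (if Function.Injective e then (0 : ℝ) else 1)
      ≤ 𝔼 e : κ → U, ∑ p ∈ Finset.univ.filter (fun p : κ × κ => p.1 ≠ p.2),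
          (if e p.1 = e p.2 then (1 : ℝ) else 0) := by
        refine Finset.expect_le_expect fun e _ => ?_
        have h0 : ∀ p : κ × κ, (0 : ℝ) ≤ if e p.1 = e p.2 then (1 : ℝ) else 0 := fun p => by
          split_ifs <;> norm_num
        split_ifs with h
        · exact Finset.sum_nonneg fun p _ => h0 p
        · simp only [Function.Injective, not_forall] at h
          obtain ⟨i, j, hij, hne⟩ := h
          have := Finset.single_le_sum (f := fun p : κ × κ => if e p.1 = e p.2 then (1 : ℝ) else 0)
            (fun p _ => h0 p) (show (i, j) ∈ Finset.univ.filter (fun p : κ × κ => p.1 ≠ p.2) by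
              simpa using hne)
          simpa [hij] using this
    _ = ∑ p ∈ Finset.univ.filter (fun p : κ × κ => p.1 ≠ p.2), (1 / Fintype.card U : ℝ) := by
        rw [Finset.expect_sum_comm]
        exact Finset.sum_congr rfl fun p hp => hpair _ _ (by simpa using hp)
    _ ≤ (Fintype.card κ : ℝ) ^ 2 / Fintype.card U := by
        rw [Finset.sum_const, nsmul_eq_mul, mul_one_div]
        gcongr
        calc ((Finset.univ.filter (fun p : κ × κ => p.1 ≠ p.2)).card : ℝ)
            ≤ Fintype.card (κ × κ) := by exact_mod_cast Finset.card_le_univ _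
          _ = _ := by rw [Fintype.card_prod]; push_cast; ring

/-- Second moment bound: for a random map `f : U → V`, the average of `g` over the `κ`-tuples from the
sample `f` has variance `O(1 / |U|)` around the average of `g` over all `κ`-tuples of `V`, since two
tuples of sample points without a common or repeated point are independent. -/
theorem expect_sample_sub_sq_le {V U : Type*} [Fintype V] [Nonempty V] [Fintype U] [Nonempty U]
    [DecidableEq U] {κ : Type*} [Fintype κ] [DecidableEq κ]
    (g : (κ → V) → ℝ) (h0 : ∀ h, 0 ≤ g h) (h1 : ∀ h, g h ≤ 1) :
    𝔼 f : U → V, (𝔼 e : κ → U, g (f ∘ e) - 𝔼 h : κ → V, g h) ^ 2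
      ≤ (2 * Fintype.card κ : ℝ) ^ 2 / Fintype.card U := by
  classical
  set t := 𝔼 h : κ → V, g h with ht
  have ht0 : 0 ≤ t := Finset.expect_nonneg fun h _ => h0 h
  have ht1 : t ≤ 1 := Finset.expect_le Finset.univ_nonempty fun h _ => h1 h
  have hpair : ∀ e : κ ⊕ κ → U,
      𝔼 f : U → V, (g (f ∘ e ∘ Sum.inl) - t) * (g (f ∘ e ∘ Sum.inr) - t)
        ≤ if Function.Injective e then (0 : ℝ) else 1 := by
    intro e
    split_ifs with he
    · have := expect_comp_injective (V := V) he
        fun h => (g (h ∘ Sum.inl) - t) * (g (h ∘ Sum.inr) - t)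
      simp only [Function.comp_assoc] at this
      rw [this, expect_sum_arrow fun x y => (g x - t) * (g y - t)]
      simp only [← Finset.mul_expect, Finset.expect_sub_distrib, Fintype.expect_const, ← ht]
      simp
    · refine Finset.expect_le Finset.univ_nonempty fun f _ => ?_
      have a0 := h0 (f ∘ e ∘ Sum.inl)
      have a1 := h1 (f ∘ e ∘ Sum.inl)
      have b0 := h0 (f ∘ e ∘ Sum.inr)
      have b1 := h1 (f ∘ e ∘ Sum.inr)
      exact (le_abs_self _).trans (by
        rw [abs_mul]
        exact mul_le_one₀ (abs_le.2 ⟨by linarith, by linarith⟩) (abs_nonneg _)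
          (abs_le.2 ⟨by linarith, by linarith⟩))
  calc 𝔼 f : U → V, (𝔼 e : κ → U, g (f ∘ e) - t) ^ 2
      = 𝔼 f : U → V, 𝔼 e : κ ⊕ κ → U, (g (f ∘ e ∘ Sum.inl) - t) * (g (f ∘ e ∘ Sum.inr) - t) := by
        refine Finset.expect_congr rfl fun f _ => ?_
        have := expect_sum_arrow (V := U) fun x y : κ → U => (g (f ∘ x) - t) * (g (f ∘ y) - t)
        simp only [← Function.comp_assoc] at this ⊢
        rw [this]
        simp only [← Finset.mul_expect, ← Finset.expect_mul, Finset.expect_sub_distrib,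
          Fintype.expect_const]
        ring
    _ = 𝔼 e : κ ⊕ κ → U, 𝔼 f : U → V, (g (f ∘ e ∘ Sum.inl) - t) * (g (f ∘ e ∘ Sum.inr) - t) :=
        Finset.expect_comm _ _ _
    _ ≤ 𝔼 e : κ ⊕ κ → U, (if Function.Injective e then (0 : ℝ) else 1) :=
        Finset.expect_le_expect fun e _ => hpair e
    _ ≤ _ := by
        refine expect_not_injective_le.trans (le_of_eq ?_)
        rw [Fintype.card_sum]; push_cast; ring

/-! ### Weights of triples and the sampling argument -/

/-- The weight of a triple as a triangle of the `0`-`1` kernel `a`. -/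
def cliqueWeight {V : Type*} (a : V → V → ℝ) (h : Fin 3 → V) : ℝ :=
  a (h 0) (h 1) * a (h 0) (h 2) * a (h 1) (h 2)

/-- The weight of a triple as an empty triple of the `0`-`1` kernel `a`. -/
def anticliqueWeight {V : Type*} (a : V → V → ℝ) (h : Fin 3 → V) : ℝ :=
  (1 - a (h 0) (h 1)) * (1 - a (h 0) (h 2)) * (1 - a (h 1) (h 2))

/-- The weight of a triple as an induced path with middle vertex `h 1` in the `0`-`1` kernel `a`. -/
def cherryWeight {V : Type*} (a : V → V → ℝ) (h : Fin 3 → V) : ℝ :=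
  a (h 0) (h 1) * (1 - a (h 0) (h 2)) * a (h 1) (h 2)

/-- The adjacency kernel of `G` with loops: `1` if `x = y` or `x` is adjacent to `y`, and `0` otherwise.
With loops, `G` is a disjoint union of cliques exactly if the kernel is an equivalence relation. -/
noncomputable def closedAdj {V : Type*} (G : SimpleGraph V) (x y : V) : ℝ :=
  open Classical in if x = y ∨ G.Adj x y then 1 else 0

theorem closedAdj_eq_zero_or_one {V : Type*} (G : SimpleGraph V) (x y : V) :
    closedAdj G x y = 0 ∨ closedAdj G x y = 1 := by
  unfold closedAdj; split_ifs <;> simp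

theorem closedAdj_self {V : Type*} (G : SimpleGraph V) (x : V) : closedAdj G x x = 1 := by
  simp [closedAdj]

theorem closedAdj_comm {V : Type*} (G : SimpleGraph V) (x y : V) :
    closedAdj G x y = closedAdj G y x := by
  unfold closedAdj
  classical exact if_congr (or_congr eq_comm (G.adj_comm x y)) rfl rfl

/-- Goodman's bound. The sum of the two weights only involves pairs of edges, so its average is
`1 / 4 + 3 * 𝔼 (d x - 1 / 2) ^ 2` in terms of the relative degrees `d x`. -/
theorem expect_cliqueWeight_add_anticliqueWeight {V : Type*} [Fintype V] [Nonempty V]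
    {a : V → V → ℝ} (ha : ∀ x y, a x y = a y x) :
    1 / 4 ≤ 𝔼 h, cliqueWeight a h + 𝔼 h, anticliqueWeight a h := by
  set d : V → ℝ := fun x => 𝔼 y, a x y with hd
  have e1 : 𝔼 h : Fin 3 → V, a (h 0) (h 1) = 𝔼 x, d x := by
    rw [expect_fin_three]; simp [hd]
  have e2 : 𝔼 h : Fin 3 → V, a (h 0) (h 2) = 𝔼 x, d x := by
    rw [expect_fin_three]; simp [hd]
  have e3 : 𝔼 h : Fin 3 → V, a (h 1) (h 2) = 𝔼 x, d x := by
    rw [expect_fin_three]; simp [hd]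
  have e4 : 𝔼 h : Fin 3 → V, a (h 0) (h 1) * a (h 0) (h 2) = 𝔼 x, d x ^ 2 := by
    rw [expect_fin_three]; simp [hd, ← Finset.mul_expect, ← Finset.expect_mul, sq]
  have e5 : 𝔼 h : Fin 3 → V, a (h 0) (h 1) * a (h 1) (h 2) = 𝔼 x, d x ^ 2 := by
    rw [expect_fin_three, Finset.expect_comm]
    simp only [Matrix.cons_val_zero, Matrix.cons_val_one, Matrix.cons_val, ← Finset.mul_expect,
      ← Finset.expect_mul]
    refine Finset.expect_congr rfl fun x _ => ?_
    rw [sq, Finset.expect_congr rfl fun i _ => ha i x]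
  have e6 : 𝔼 h : Fin 3 → V, a (h 0) (h 2) * a (h 1) (h 2) = 𝔼 x, d x ^ 2 := by
    rw [expect_fin_three, Finset.expect_congr rfl fun x _ => Finset.expect_comm _ _ _,
      Finset.expect_comm]
    simp only [Matrix.cons_val_zero, Matrix.cons_val_one, Matrix.cons_val, ← Finset.mul_expect,
      ← Finset.expect_mul]
    refine Finset.expect_congr rfl fun x _ => ?_
    rw [sq, Finset.expect_congr rfl fun i _ => ha i x]
  have hnn : 0 ≤ 𝔼 x, (d x - 1 / 2) ^ 2 := Finset.expect_nonneg fun x _ => sq_nonneg _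
  have hexp : 𝔼 x, (d x - 1 / 2) ^ 2 = 𝔼 x, d x ^ 2 - 𝔼 x, d x + 1 / 4 := by
    rw [← Finset.expect_sub_distrib, ← Fintype.expect_const (ι := V) (1 / 4 : ℝ),
      ← Finset.expect_add_distrib]
    exact Finset.expect_congr rfl fun x _ => by ring
  have : 𝔼 h, cliqueWeight a h + 𝔼 h, anticliqueWeight a h
      = 1 - 3 * 𝔼 x, d x + 3 * 𝔼 x, d x ^ 2 := by
    calc _ = 𝔼 h : Fin 3 → V, (1 - a (h 0) (h 1) - a (h 0) (h 2) - a (h 1) (h 2)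
          + a (h 0) (h 1) * a (h 0) (h 2) + a (h 0) (h 1) * a (h 1) (h 2)
          + a (h 0) (h 2) * a (h 1) (h 2)) := by
          rw [← Finset.expect_add_distrib]
          exact Finset.expect_congr rfl fun h _ => by
            unfold cliqueWeight anticliqueWeight; ring
      _ = _ := by
          simp only [Finset.expect_add_distrib, Finset.expect_sub_distrib, e1, e2, e3, e4, e5, e6,
            Fintype.expect_const]
          ring
  linarith

/-- The fraction of the points that have colour `i`. -/
noncomputable def partSize {U ι : Type*} [Fintype U] [DecidableEq ι] (c : U → ι) (i : ι) : ℝ :=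
  𝔼 u, if c u = i then (1 : ℝ) else 0

theorem partSize_mem_stdSimplex {U ι : Type*} [Fintype U] [Nonempty U] [Fintype ι] [DecidableEq ι]
    (c : U → ι) : partSize c ∈ stdSimplex ℝ ι := by
  refine ⟨fun i => Finset.expect_nonneg fun u _ => by split_ifs <;> norm_num, ?_⟩
  simp only [partSize]
  rw [← Finset.expect_sum_comm]
  simp

theorem expect_cliqueWeight_partition {U ι : Type*} [Fintype U] [Fintype ι] [DecidableEq ι]
    (c : U → ι) :
    𝔼 h, cliqueWeight (fun u v => if c u = c v then (1 : ℝ) else 0) h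
      = ∑ i, partSize c i ^ 3 := by
  have : ∀ h : Fin 3 → U, cliqueWeight (fun u v => if c u = c v then (1 : ℝ) else 0) h
      = ∑ i, (if c (h 0) = i then (1 : ℝ) else 0) * (if c (h 1) = i then 1 else 0)
        * (if c (h 2) = i then 1 else 0) := by
    intro h
    rw [Finset.sum_eq_single (c (h 0)) (fun i _ hi => by simp [hi.symm]) (by simp)]
    unfold cliqueWeight
    by_cases h1 : c (h 0) = c (h 1) <;> by_cases h2 : c (h 0) = c (h 2) <;>
      simp [h1, h2, eq_comm]
  simp only [this, Finset.expect_sum_comm, partSize]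
  refine Finset.sum_congr rfl fun i _ => ?_
  have hφ : ∀ φ : U → ℝ, 𝔼 x, 𝔼 y, 𝔼 z, φ x * φ y * φ z = (𝔼 x, φ x) ^ 3 := fun φ => by
    simp only [← Finset.mul_expect, ← Finset.expect_mul]
    ring
  rw [expect_fin_three]
  exact hφ fun u => if c u = i then 1 else 0

/-- For an equivalence kernel the product of the three factors `1 - k` collapses, because the product
of any two of the three values of `k` is the product of all three. -/
theorem expect_anticliqueWeight_partition {U ι : Type*} [Fintype U] [Nonempty U] [Fintype ι]
    [DecidableEq ι] (c : U → ι) :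
    𝔼 h, anticliqueWeight (fun u v => if c u = c v then (1 : ℝ) else 0) h
      = 1 - 3 * ∑ i, partSize c i ^ 2 + 2 * ∑ i, partSize c i ^ 3 := by
  set k : U → U → ℝ := fun u v => if c u = c v then (1 : ℝ) else 0 with hk
  have hE : 𝔼 x, 𝔼 y, k x y = ∑ i, partSize c i ^ 2 := by
    have : ∀ x y, k x y = ∑ i, (if c x = i then (1 : ℝ) else 0) * (if c y = i then 1 else 0) := by
      intro x y
      simp [hk, eq_comm]
    simp only [this, Finset.expect_sum_comm, ← Finset.mul_expect, ← Finset.expect_mul, partSize, sq]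
  have e1 : 𝔼 h : Fin 3 → U, k (h 0) (h 1) = 𝔼 x, 𝔼 y, k x y := by
    rw [expect_fin_three]; simp
  have e2 : 𝔼 h : Fin 3 → U, k (h 0) (h 2) = 𝔼 x, 𝔼 y, k x y := by
    rw [expect_fin_three]; simp
  have e3 : 𝔼 h : Fin 3 → U, k (h 1) (h 2) = 𝔼 x, 𝔼 y, k x y := by
    rw [expect_fin_three]; simp
  calc 𝔼 h, anticliqueWeight k h
      = 𝔼 h : Fin 3 → U, (1 - k (h 0) (h 1) - k (h 0) (h 2) - k (h 1) (h 2)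
          + 2 * cliqueWeight k h) := by
        refine Finset.expect_congr rfl fun h _ => ?_
        simp only [anticliqueWeight, cliqueWeight, hk]
        by_cases h1 : c (h 0) = c (h 1) <;> by_cases h2 : c (h 0) = c (h 2) <;>
          by_cases h3 : c (h 1) = c (h 2) <;> (simp_all; try norm_num)
    _ = _ := by
        simp only [Finset.expect_add_distrib, Finset.expect_sub_distrib, e1, e2, e3, hE,
          Fintype.expect_const, ← Finset.mul_expect]
        rw [hk, expect_cliqueWeight_partition]
        ring

/-- If `G` has few cherries, some sample of `m` points spans no cherry and has at most `η` more
triangles and at most `η` more empty triples than `G`, as proportions of all triples. -/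
theorem exists_sample_cherryFree {V : Type*} [Fintype V] [Nonempty V] (G : SimpleGraph V) {η : ℝ}
    (hη : 0 < η) {m : ℕ} (hm : 0 < m) (hmη : 288 / η ^ 2 ≤ m)
    (hq : 𝔼 h, cherryWeight (closedAdj G) h < 1 / (2 * m ^ 3)) :
    ∃ f : Fin m → V, (∀ e : Fin 3 → Fin m, cherryWeight (closedAdj G) (f ∘ e) = 0) ∧
      𝔼 e : Fin 3 → Fin m, cliqueWeight (closedAdj G) (f ∘ e)
        < 𝔼 h, cliqueWeight (closedAdj G) h + η ∧
      𝔼 e : Fin 3 → Fin m, anticliqueWeight (closedAdj G) (f ∘ e)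
        < 𝔼 h, anticliqueWeight (closedAdj G) h + η := by
  classical
  have : NeZero m := ⟨hm.ne'⟩
  have hm' : (0 : ℝ) < m := by exact_mod_cast hm
  set a := closedAdj G with ha
  have ha0 : ∀ x y, 0 ≤ a x y := fun x y => by
    rcases closedAdj_eq_zero_or_one G x y with h | h <;> rw [ha, h]; norm_num
  have ha1 : ∀ x y, 0 ≤ 1 - a x y := fun x y => by
    rcases closedAdj_eq_zero_or_one G x y with h | h <;> rw [ha, h] <;> norm_num
  have c0 : ∀ h, 0 ≤ cliqueWeight a h := fun h => mul_nonneg (mul_nonneg (ha0 _ _) (ha0 _ _)) (ha0 _ _)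
  have c1 : ∀ h, cliqueWeight a h ≤ 1 := fun h =>
    mul_le_one₀ (mul_le_one₀ (sub_nonneg.1 (ha1 _ _)) (ha0 _ _) (sub_nonneg.1 (ha1 _ _))) (ha0 _ _)
      (sub_nonneg.1 (ha1 _ _))
  have d0 : ∀ h, 0 ≤ anticliqueWeight a h := fun h =>
    mul_nonneg (mul_nonneg (ha1 _ _) (ha1 _ _)) (ha1 _ _)
  have d1 : ∀ h, anticliqueWeight a h ≤ 1 := fun h =>
    mul_le_one₀ (mul_le_one₀ (sub_le_self _ (ha0 _ _)) (ha1 _ _) (sub_le_self _ (ha0 _ _)))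
      (ha1 _ _) (sub_le_self _ (ha0 _ _))
  have q0 : ∀ h, 0 ≤ cherryWeight a h := fun h =>
    mul_nonneg (mul_nonneg (ha0 _ _) (ha1 _ _)) (ha0 _ _)
  have hvC := expect_sample_sub_sq_le (U := Fin m) (cliqueWeight a) c0 c1
  have hvA := expect_sample_sub_sq_le (U := Fin m) (anticliqueWeight a) d0 d1
  have hY : 𝔼 f : Fin m → V, ∑ e : Fin 3 → Fin m, cherryWeight a (f ∘ e)
      ≤ m ^ 3 * 𝔼 h, cherryWeight a h := by
    rw [Finset.expect_sum_comm]
    calc ∑ e : Fin 3 → Fin m, 𝔼 f : Fin m → V, cherryWeight a (f ∘ e)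
        ≤ ∑ e : Fin 3 → Fin m, 𝔼 h, cherryWeight a h := by
          refine Finset.sum_le_sum fun e _ => ?_
          -- A triple with a repeated point is never a cherry, because of the loops.
          by_cases he : Function.Injective e
          · rw [expect_comp_injective he]
          · refine (le_of_eq ?_).trans (Finset.expect_nonneg fun h _ => q0 h)
            refine Finset.expect_eq_zero fun f _ => ?_
            have : e 0 = e 1 ∨ e 0 = e 2 ∨ e 1 = e 2 := by
              by_contra! hne
              refine he fun i j hij => ?_
              fin_cases i <;> fin_cases j <;> simp_all
            simp only [cherryWeight, Function.comp_apply]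
            rcases this with h | h | h
            · rw [h, ha, closedAdj_self, one_mul]
              rcases closedAdj_eq_zero_or_one G (f (e 1)) (f (e 2)) with h | h <;> simp [h]
            · rw [h, ha, closedAdj_self]; simp
            · rw [h, ha, closedAdj_self]
              rcases closedAdj_eq_zero_or_one G (f (e 0)) (f (e 2)) with h | h <;> simp [h]
      _ = _ := by simp
  set tC := 𝔼 h, cliqueWeight a h with htC
  set tA := 𝔼 h, anticliqueWeight a h with htA
  have hη2 : (0 : ℝ) < η ^ 2 := by positivity
  -- A sample at which this sum is below `1` has all three properties.
  have hsum : 𝔼 f : Fin m → V, ((𝔼 e : Fin 3 → Fin m, cliqueWeight a (f ∘ e) - tC) ^ 2 / η ^ 2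
      + (𝔼 e : Fin 3 → Fin m, anticliqueWeight a (f ∘ e) - tA) ^ 2 / η ^ 2
      + ∑ e : Fin 3 → Fin m, cherryWeight a (f ∘ e)) < 1 := by
    rw [Finset.expect_add_distrib, Finset.expect_add_distrib, ← Finset.expect_div,
      ← Finset.expect_div]
    simp only [Fintype.card_fin] at hvC hvA
    have hb : (2 * ((3 : ℕ) : ℝ)) ^ 2 / m / η ^ 2 ≤ 1 / 8 := by
      rw [div_le_iff₀ hη2] at hmη
      rw [div_div, div_le_iff₀ (by positivity)]
      push_cast
      linarith
    have b1 := (div_le_div_of_nonneg_right hvC hη2.le).trans hb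
    have b2 := (div_le_div_of_nonneg_right hvA hη2.le).trans hb
    have b3 : (m : ℝ) ^ 3 * 𝔼 h, cherryWeight a h < 1 / 2 := by
      rw [lt_div_iff₀ (by positivity)] at hq
      linarith
    linarith
  obtain ⟨f, -, hf⟩ := Finset.exists_lt_of_expect_lt Finset.univ_nonempty hsum
  have hY0 : 0 ≤ ∑ e : Fin 3 → Fin m, cherryWeight a (f ∘ e) := Finset.sum_nonneg fun e _ => q0 _
  have hdev : ∀ x y : ℝ, (x - y) ^ 2 / η ^ 2 < 1 → x < y + η := by
    intro x y h
    rw [div_lt_one hη2] at h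
    linarith [(abs_lt_of_sq_lt_sq' h hη.le).2]
  have hs1 := div_nonneg (sq_nonneg (𝔼 e : Fin 3 → Fin m, cliqueWeight a (f ∘ e) - tC)) hη2.le
  have hs2 := div_nonneg (sq_nonneg (𝔼 e : Fin 3 → Fin m, anticliqueWeight a (f ∘ e) - tA)) hη2.le
  refine ⟨f, fun e => ?_, hdev _ _ (by linarith), hdev _ _ (by linarith)⟩
  have hle : cherryWeight a (f ∘ e) < 1 :=
    (Finset.single_le_sum (f := fun e : Fin 3 → Fin m => cherryWeight a (f ∘ e))
      (fun e _ => q0 _) (Finset.mem_univ e)).trans_lt (by linarith)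
  simp only [cherryWeight, Function.comp_apply, ha] at hle ⊢
  rcases closedAdj_eq_zero_or_one G (f (e 0)) (f (e 1)) with h | h <;>
    rcases closedAdj_eq_zero_or_one G (f (e 0)) (f (e 2)) with h' | h' <;>
    rcases closedAdj_eq_zero_or_one G (f (e 1)) (f (e 2)) with h'' | h'' <;>
    simp [h, h', h''] at hle ⊢

/-- The extremal inequality carries over, with an error `η`, to all graphs with few cherries. -/
theorem le_max_of_expect_cherryWeight_lt {θ : ℝ}
    (hθ : θ ^ 3 + θ ^ 2 - θ + 1 / 6 = 0) (h1 : 0.4273725 < θ) (h2 : θ < 0.4273735) {η : ℝ}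
    (hη : 0 < η) : ∃ ε > 0, ∀ {V : Type*} [Fintype V] [Nonempty V] (G : SimpleGraph V),
      𝔼 h, cherryWeight (closedAdj G) h < ε →
      6 * θ ^ 2 * (1 - 2 * θ) - η
        ≤ max (𝔼 h, cliqueWeight (closedAdj G) h) (𝔼 h, anticliqueWeight (closedAdj G) h) := by
  classical
  obtain ⟨m, hm⟩ := exists_nat_ge (288 / η ^ 2)
  have hm0 : 0 < m := by
    have : (0 : ℝ) < m := lt_of_lt_of_le (by positivity) hm
    exact_mod_cast this
  have : NeZero m := ⟨hm0.ne'⟩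
  refine ⟨1 / (2 * m ^ 3), by positivity, fun {V} _ _ G hq => ?_⟩
  obtain ⟨f, hf, hC, hA⟩ := exists_sample_cherryFree G hη hm0 hm hq
  -- Without cherries, the kernel on the sample points is an equivalence relation.
  let S : Setoid (Fin m) :=
    { r := fun u v => closedAdj G (f u) (f v) = 1
      iseqv :=
        { refl := fun u => closedAdj_self G _
          symm := fun {u v} h => by rw [closedAdj_comm, h]
          trans := fun {u v w} h h' => by
            have := hf ![u, v, w]
            simp only [cherryWeight, Function.comp_apply, Matrix.cons_val_zero,
              Matrix.cons_val_one, Matrix.cons_val] at this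
            rw [h, h'] at this
            linarith } }
  let c : Fin m → Quotient S := Quotient.mk S
  have hc : (fun u v => closedAdj G (f u) (f v)) = fun u v => if c u = c v then (1 : ℝ) else 0 := by
    ext u v
    have : c u = c v ↔ closedAdj G (f u) (f v) = 1 := Quotient.eq (r := S)
    rcases closedAdj_eq_zero_or_one G (f u) (f v) with h | h <;> simp [this, h]
  have eC := expect_cliqueWeight_partition c
  have eA := expect_anticliqueWeight_partition c
  rw [← hc] at eC eA
  have key := le_max_sum_pow_of_mem_stdSimplex hθ h1 h2 (partSize_mem_stdSimplex c)
  rw [← eA, ← eC] at key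
  rcases le_max_iff.1 key with h | h
  · exact le_max_of_le_left (sub_le_iff_le_add.2 (h.trans hC.le))
  · exact le_max_of_le_right (sub_le_iff_le_add.2 (h.trans hA.le))

/-! ### Induced densities and random triples -/

theorem card_filter_injective_image_eq {V : Type*} [Fintype V] [DecidableEq V] {s : Finset V}
    (hs : s.card = 3) :
    (Finset.univ.filter fun h : Fin 3 → V =>
      Function.Injective h ∧ Finset.univ.image h = s).card = 6 := by
  have : Fintype.card (Fin 3 ≃ s) = 6 := by
    rw [Fintype.card_equiv (Fintype.equivOfCardEq (by simp [hs]))]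
    simp [Nat.factorial]
  rw [← this, ← Finset.card_univ]
  symm
  refine Finset.card_bij (fun e _ j => (e j : V)) (fun e _ => ?_) (fun e _ e' _ h => ?_)
    fun h hh => ?_
  · simp only [Finset.mem_filter, Finset.mem_univ, true_and]
    refine ⟨Subtype.val_injective.comp e.injective, ?_⟩
    ext v
    simp only [Finset.mem_image, Finset.mem_univ, true_and]
    exact ⟨fun ⟨j, hj⟩ => hj ▸ (e j).2, fun hv => ⟨e.symm ⟨v, hv⟩, by simp⟩⟩
  · ext j; exact congrFun h j
  · simp only [Finset.mem_filter, Finset.mem_univ, true_and] at hh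
    obtain ⟨hi, rfl⟩ := hh
    refine ⟨Equiv.ofBijective (fun j => ⟨h j, Finset.mem_image_of_mem _ (Finset.mem_univ j)⟩)
      ⟨fun a b hab => hi (congrArg Subtype.val hab), fun ⟨v, hv⟩ => ?_⟩, Finset.mem_univ _, rfl⟩
    obtain ⟨j, -, rfl⟩ := Finset.mem_image.1 hv
    exact ⟨j, rfl⟩

theorem nonempty_iso_comap_iff {V : Type*} [DecidableEq V] (H : SimpleGraph (Fin 3))
    (G : SimpleGraph V) {h : Fin 3 → V} (hi : Function.Injective h) {s : Finset V}
    (hs : Finset.univ.image h = s) :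
    Nonempty (H ≃g G.comap h) ↔ Nonempty (H ≃g G.induce (s : Set V)) := by
  subst hs
  have e : G.comap h ≃g G.induce ((Finset.univ.image h : Finset V) : Set V) :=
    { toEquiv := Equiv.ofBijective
        (fun j => ⟨h j, by simp⟩)
        ⟨fun a b hab => hi (congrArg Subtype.val hab), fun ⟨v, hv⟩ => by
          simp only [Finset.coe_image, Finset.coe_univ, Set.image_univ, Set.mem_range] at hv
          obtain ⟨j, rfl⟩ := hv
          exact ⟨j, rfl⟩⟩
      map_rel_iff' := Iff.rfl }
  exact ⟨fun ⟨f⟩ => ⟨f.trans e⟩, fun ⟨f⟩ => ⟨f.trans e.symm⟩⟩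

/-- `inducedDensity` samples three vertices without replacement; sampling with replacement and asking
for three distinct vertices spanning `H` gives the same up to `3 / |V|`. -/
theorem expect_copy_bounds {V : Type*} [Fintype V] (H : SimpleGraph (Fin 3))
    (G : SimpleGraph V) (hV : 3 ≤ Fintype.card V)
    [DecidablePred fun h : Fin 3 → V => Function.Injective h ∧ Nonempty (H ≃g G.comap h)] :
    𝔼 h : Fin 3 → V, (if Function.Injective h ∧ Nonempty (H ≃g G.comap h) then (1 : ℝ) else 0)
        ≤ inducedDensity H G ∧
      inducedDensity H G ≤
        𝔼 h : Fin 3 → V, (if Function.Injective h ∧ Nonempty (H ≃g G.comap h) then (1 : ℝ) else 0)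
          + 3 / Fintype.card V := by
  classical
  set n := Fintype.card V with hn
  have hne : Nonempty V := Fintype.card_pos_iff.1 (by omega)
  set S := ((Finset.univ : Finset V).powersetCard 3).filter
    (fun s : Finset V => Nonempty (H ≃g G.induce (s : Set V))) with hS
  set T := Finset.univ.filter fun h : Fin 3 → V =>
    Function.Injective h ∧ Nonempty (H ≃g G.comap h) with hT
  have hTS : T.card = 6 * S.card := by
    have hmaps : ∀ h ∈ T, Finset.univ.image h ∈ S := by
      intro h hh
      simp only [hT, Finset.mem_filter, Finset.mem_univ, true_and] at hh
      simp only [hS, Finset.mem_filter, Finset.mem_powersetCard, Finset.subset_univ, true_and]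
      exact ⟨by rw [Finset.card_image_of_injective _ hh.1]; simp,
        (nonempty_iso_comap_iff H G hh.1 rfl).1 hh.2⟩
    rw [Finset.card_eq_sum_card_fiberwise hmaps, Finset.sum_const_nat (m := 6), mul_comm]
    intro s hs
    simp only [hS, Finset.mem_filter, Finset.mem_powersetCard, Finset.subset_univ, true_and] at hs
    rw [← card_filter_injective_image_eq hs.1, hT, Finset.filter_filter]
    congr 1
    ext h
    simp only [Finset.mem_filter, Finset.mem_univ, true_and]
    exact ⟨fun ⟨⟨h1, _⟩, h3⟩ => ⟨h1, h3⟩,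
      fun ⟨h1, h3⟩ => ⟨⟨h1, (nonempty_iso_comap_iff H G h1 h3).2 hs.2⟩, h3⟩⟩
  have hp : inducedDensity H G = S.card / (n.choose 3 : ℝ) := by
    unfold inducedDensity
    simp only [Fintype.card_fin, hS]
    congr!
  have hτ : 𝔼 h : Fin 3 → V,
      (if Function.Injective h ∧ Nonempty (H ≃g G.comap h) then (1 : ℝ) else 0)
        = T.card / (n : ℝ) ^ 3 := by
    rw [Fintype.expect_eq_sum_div_card, Finset.sum_boole]
    simp [hT, hn]
  have hn3 : (3 : ℝ) ≤ n := by exact_mod_cast hV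
  have hchoose : (6 : ℝ) * n.choose 3 = n * (n - 1) * (n - 2) := by
    have h1 := Nat.descFactorial_eq_factorial_mul_choose n 3
    have h2 : ((n.descFactorial 3 : ℕ) : ℝ) = n * (n - 1) * (n - 2) := by
      simp only [Nat.descFactorial_succ, Nat.descFactorial_zero]
      push_cast [Nat.cast_sub (show 1 ≤ n by omega), Nat.cast_sub (show 2 ≤ n by omega)]
      simp; ring
    rw [← h2, h1]; simp [Nat.factorial]
  have hpos : (0 : ℝ) < n * (n - 1) * (n - 2) :=
    mul_pos (mul_pos (by linarith) (by linarith)) (by linarith)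
  have hp' : inducedDensity H G = T.card / ((n : ℝ) * (n - 1) * (n - 2)) := by
    rw [hp, hTS, ← hchoose]; push_cast
    rw [mul_div_mul_left _ _ (by norm_num)]
  have hcard : (S.card : ℝ) ≤ n.choose 3 := by
    have := Finset.card_filter_le ((Finset.univ : Finset V).powersetCard 3)
      (fun s : Finset V => Nonempty (H ≃g G.induce (s : Set V)))
    rw [Finset.card_powersetCard, Finset.card_univ] at this
    exact_mod_cast this
  have hTle : (T.card : ℝ) ≤ n * (n - 1) * (n - 2) := by
    rw [← hchoose, hTS]; push_cast; linarith
  rw [hτ, hp']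
  constructor
  · gcongr
    nlinarith
  · have hn0 : (0 : ℝ) < n := by linarith
    have hle : (T.card : ℝ) / (n * (n - 1) * (n - 2)) ≤ 1 := (div_le_one hpos).2 hTle
    have h0 : (0 : ℝ) ≤ T.card / (n * (n - 1) * (n - 2)) := by positivity
    have e : (T.card : ℝ) / (n * (n - 1) * (n - 2)) - T.card / (n : ℝ) ^ 3
        = T.card / (n * (n - 1) * (n - 2)) * (3 / n - 2 / n ^ 2) := by
      have hd := hpos.ne'
      have h1 : ((n : ℝ) * (n - 1) * (n - 2)) = n ^ 3 * (1 - (3 / n - 2 / n ^ 2)) := by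
        field_simp; ring
      have h2 : (T.card : ℝ) / n ^ 3 = T.card / (n * (n - 1) * (n - 2)) * (1 - (3 / n - 2 / n ^ 2)) := by
        rw [div_mul_eq_mul_div, div_eq_div_iff (by positivity) hd, h1]; ring
      rw [h2]; ring
    have h3 : (0 : ℝ) ≤ 3 / n - 2 / n ^ 2 := by
      rw [sub_nonneg, div_le_div_iff₀ (by positivity) hn0]; nlinarith
    have h4 := mul_le_of_le_one_left h3 hle
    have h5 : (0 : ℝ) ≤ 2 / n ^ 2 := by positivity
    linarith

/-! ### Three-vertex graphs and their densities -/

theorem inducedDensity_nonneg {W V : Type*} [Fintype W] [Fintype V] (H : SimpleGraph W)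
    (G : SimpleGraph V) : 0 ≤ inducedDensity H G := by
  unfold inducedDensity; positivity

theorem inducedDensity_le_one {W V : Type*} [Fintype W] [Fintype V] (H : SimpleGraph W)
    (G : SimpleGraph V) : inducedDensity H G ≤ 1 := by
  classical
  unfold inducedDensity
  refine div_le_one_of_le₀ ?_ (by positivity)
  have := Finset.card_filter_le ((Finset.univ : Finset V).powersetCard (Fintype.card W))
      (fun s : Finset V => Nonempty (H ≃g G.induce (s : Set V)))
  rw [Finset.card_powersetCard, Finset.card_univ] at this
  refine le_trans (le_of_eq ?_) (Nat.cast_le.2 this)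
  congr!

theorem nonempty_iso_compl {V W : Type*} {G : SimpleGraph V} {H : SimpleGraph W}
    (h : Nonempty (G ≃g H)) : Nonempty (Gᶜ ≃g Hᶜ) := by
  obtain ⟨f⟩ := h
  exact ⟨{ toEquiv := f.toEquiv
           map_rel_iff' := fun {a b} => by
            simp [SimpleGraph.compl_adj, f.map_adj_iff] }⟩

theorem inducedDensity_compl {W V : Type*} [Fintype W] [Fintype V] (H : SimpleGraph W)
    (G : SimpleGraph V) : inducedDensity Hᶜ Gᶜ = inducedDensity H G := by
  have key : ∀ s : Finset V,
      Nonempty (Hᶜ ≃g Gᶜ.induce (s : Set V)) ↔ Nonempty (H ≃g G.induce (s : Set V)) := by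
    intro s
    have hs : Gᶜ.induce (s : Set V) = (G.induce (s : Set V))ᶜ := by
      ext a b
      exact and_congr (not_congr Subtype.ext_iff.symm) Iff.rfl
    rw [hs]
    refine ⟨fun h => ?_, nonempty_iso_compl⟩
    have := nonempty_iso_compl h
    rwa [compl_compl, compl_compl] at this
  unfold inducedDensity
  refine congrArg (fun k : ℕ => (k : ℝ) / _) (congrArg Finset.card ?_)
  ext s
  simp only [Finset.mem_filter, key]

/-- A 3-vertex graph that is neither empty nor complete has exactly one or exactly two edges, so it or
its complement is a cherry. -/
theorem exists_perm_cherry (H : SimpleGraph (Fin 3)) (h1 : H ≠ ⊥) (h2 : H ≠ ⊤) :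
    (∃ σ : Equiv.Perm (Fin 3), H.Adj (σ 0) (σ 1) ∧ ¬ H.Adj (σ 0) (σ 2) ∧ H.Adj (σ 1) (σ 2)) ∨
    (∃ σ : Equiv.Perm (Fin 3), Hᶜ.Adj (σ 0) (σ 1) ∧ ¬ Hᶜ.Adj (σ 0) (σ 2) ∧ Hᶜ.Adj (σ 1) (σ 2)) := by
  have hbot : ¬ (¬ H.Adj 0 1 ∧ ¬ H.Adj 0 2 ∧ ¬ H.Adj 1 2) := by
    rintro ⟨a, b, c⟩
    refine h1 (SimpleGraph.ext (funext fun i => funext fun j => propext ?_))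
    fin_cases i <;> fin_cases j <;> simp [a, b, c, H.adj_comm 1 0, H.adj_comm 2 0, H.adj_comm 2 1]
  have htop : ¬ (H.Adj 0 1 ∧ H.Adj 0 2 ∧ H.Adj 1 2) := by
    rintro ⟨a, b, c⟩
    refine h2 (SimpleGraph.ext (funext fun i => funext fun j => propext ?_))
    fin_cases i <;> fin_cases j <;> simp [a, b, c, H.adj_comm 1 0, H.adj_comm 2 0, H.adj_comm 2 1]
  have key : ∀ K : SimpleGraph (Fin 3),
      (K.Adj 0 1 ∧ K.Adj 1 2 ∧ ¬ K.Adj 0 2) ∨ (K.Adj 0 1 ∧ K.Adj 0 2 ∧ ¬ K.Adj 1 2) ∨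
        (K.Adj 0 2 ∧ K.Adj 1 2 ∧ ¬ K.Adj 0 1) →
      ∃ σ : Equiv.Perm (Fin 3), K.Adj (σ 0) (σ 1) ∧ ¬ K.Adj (σ 0) (σ 2) ∧ K.Adj (σ 1) (σ 2) := by
    rintro K (⟨a, b, c⟩ | ⟨a, b, c⟩ | ⟨a, b, c⟩)
    · exact ⟨1, a, c, b⟩
    · have h2 : Equiv.swap (0 : Fin 3) 1 2 = 2 := by decide
      refine ⟨Equiv.swap 0 1, ?_⟩
      rw [Equiv.swap_apply_left, Equiv.swap_apply_right, h2]
      exact ⟨a.symm, c, b⟩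
    · have h0 : Equiv.swap (1 : Fin 3) 2 0 = 0 := by decide
      refine ⟨Equiv.swap 1 2, ?_⟩
      rw [Equiv.swap_apply_left, Equiv.swap_apply_right, h0]
      exact ⟨a, c, b.symm⟩
  have hc : ∀ i j : Fin 3, i ≠ j → (Hᶜ.Adj i j ↔ ¬ H.Adj i j) := fun i j hij => by
    simp [SimpleGraph.compl_adj, hij]
  have c1 := hc 0 1 (by decide)
  have c2 := hc 0 2 (by decide)
  have c3 := hc 1 2 (by decide)
  have k1 := key H
  have k2 := key Hᶜ
  rw [c1, c2, c3] at k2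
  by_cases a : H.Adj 0 1 <;> by_cases b : H.Adj 0 2 <;> by_cases c : H.Adj 1 2
  · exact absurd ⟨a, b, c⟩ htop
  · exact .inl (k1 (.inr (.inl ⟨a, b, c⟩)))
  · exact .inl (k1 (.inl ⟨a, c, b⟩))
  · exact .inr (k2 (.inr (.inr ⟨b, c, not_not.2 a⟩)))
  · exact .inl (k1 (.inr (.inr ⟨b, c, a⟩)))
  · exact .inr (k2 (.inl ⟨a, c, not_not.2 b⟩))
  · exact .inr (k2 (.inr (.inl ⟨a, b, not_not.2 c⟩)))
  · exact absurd ⟨a, b, c⟩ hbot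

theorem injective_fin_three {V : Type*} {h : Fin 3 → V} (h01 : h 0 ≠ h 1) (h02 : h 0 ≠ h 2)
    (h12 : h 1 ≠ h 2) : Function.Injective h := fun i j hij => by
  fin_cases i <;> fin_cases j <;> simp_all

theorem expect_cherryWeight_le {V : Type*} [Fintype V] {H : SimpleGraph (Fin 3)}
    {σ : Equiv.Perm (Fin 3)} (h01 : H.Adj (σ 0) (σ 1)) (h02 : ¬ H.Adj (σ 0) (σ 2))
    (h12 : H.Adj (σ 1) (σ 2)) (G : SimpleGraph V) (hV : 3 ≤ Fintype.card V) :
    𝔼 h, cherryWeight (closedAdj G) h ≤ inducedDensity H G := by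
  classical
  refine le_trans (Finset.expect_le_expect fun h _ => ?_) (expect_copy_bounds H G hV).1
  split_ifs with hh
  · unfold cherryWeight
    rcases closedAdj_eq_zero_or_one G (h 0) (h 1) with a | a <;>
    rcases closedAdj_eq_zero_or_one G (h 0) (h 2) with b | b <;>
    rcases closedAdj_eq_zero_or_one G (h 1) (h 2) with c | c <;> simp [a, b, c]
  · by_contra! hpos
    simp only [cherryWeight, closedAdj] at hpos
    by_cases a : h 0 = h 1 ∨ G.Adj (h 0) (h 1)
    swap
    · simp [a] at hpos
    by_cases b : h 0 = h 2 ∨ G.Adj (h 0) (h 2)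
    · simp [b] at hpos
    by_cases c : h 1 = h 2 ∨ G.Adj (h 1) (h 2)
    swap
    · simp [c] at hpos
    push Not at b
    have n01 : h 0 ≠ h 1 := fun e => by
      rw [← e] at c; rcases c with c | c
      exacts [b.1 c, b.2 c]
    have n12 : h 1 ≠ h 2 := fun e => by
      rw [e] at a; rcases a with a | a
      exacts [b.1 a, b.2 a]
    have a' := a.resolve_left n01
    have c' := c.resolve_left n12
    refine hh ⟨injective_fin_three n01 b.1 n12, ?_⟩
    · refine ⟨(RelIso.symm
        ({ toEquiv := σ, map_rel_iff' := fun {i j} => ?_ } : G.comap h ≃g H))⟩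
      fin_cases i <;> fin_cases j <;>
        simp [h01, h02, h12, a', c', b.2, G.adj_comm (h 1) (h 0), G.adj_comm (h 2) (h 0),
          G.adj_comm (h 2) (h 1), H.adj_comm (σ 1) (σ 0), H.adj_comm (σ 2) (σ 0),
          H.adj_comm (σ 2) (σ 1)]

theorem nonempty_iso_bot_comap_iff {V : Type*} (G : SimpleGraph V) (h : Fin 3 → V) :
    Nonempty ((⊥ : SimpleGraph (Fin 3)) ≃g G.comap h) ↔
      ¬ G.Adj (h 0) (h 1) ∧ ¬ G.Adj (h 0) (h 2) ∧ ¬ G.Adj (h 1) (h 2) := by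
  constructor
  · rintro ⟨f⟩
    have : ∀ i j, ¬ G.Adj (h i) (h j) := fun i j hij => by
      have : (⊥ : SimpleGraph (Fin 3)).Adj (f.symm i) (f.symm j) := f.symm.map_adj_iff.2 hij
      simp at this
    exact ⟨this _ _, this _ _, this _ _⟩
  · rintro ⟨a, b, c⟩
    refine ⟨{ toEquiv := Equiv.refl _, map_rel_iff' := fun {i j} => ?_ }⟩
    fin_cases i <;> fin_cases j <;> simp [a, b, c, G.adj_comm (h 1) (h 0), G.adj_comm (h 2) (h 0),
          G.adj_comm (h 2) (h 1)]

theorem nonempty_iso_top_comap_iff {V : Type*} (G : SimpleGraph V) (h : Fin 3 → V) :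
    Nonempty ((⊤ : SimpleGraph (Fin 3)) ≃g G.comap h) ↔
      G.Adj (h 0) (h 1) ∧ G.Adj (h 0) (h 2) ∧ G.Adj (h 1) (h 2) := by
  constructor
  · rintro ⟨f⟩
    have : ∀ i j, i ≠ j → G.Adj (h i) (h j) := fun i j hij =>
      f.symm.map_adj_iff.1 (show (⊤ : SimpleGraph (Fin 3)).Adj (f.symm i) (f.symm j) by simpa using hij)
    exact ⟨this _ _ (by decide), this _ _ (by decide), this _ _ (by decide)⟩
  · rintro ⟨a, b, c⟩
    refine ⟨{ toEquiv := Equiv.refl _, map_rel_iff' := fun {i j} => ?_ }⟩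
    fin_cases i <;> fin_cases j <;> simp [a, b, c, G.adj_comm (h 1) (h 0), G.adj_comm (h 2) (h 0),
          G.adj_comm (h 2) (h 1)]

theorem anticlique_bounds {V : Type*} [Fintype V] (G : SimpleGraph V) (hV : 3 ≤ Fintype.card V) :
    𝔼 h, anticliqueWeight (closedAdj G) h ≤ inducedDensity (⊥ : SimpleGraph (Fin 3)) G ∧
      inducedDensity (⊥ : SimpleGraph (Fin 3)) G
        ≤ 𝔼 h, anticliqueWeight (closedAdj G) h + 3 / Fintype.card V := by
  classical
  have : ∀ h : Fin 3 → V, anticliqueWeight (closedAdj G) h =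
      if Function.Injective h ∧ Nonempty ((⊥ : SimpleGraph (Fin 3)) ≃g G.comap h) then (1 : ℝ)
        else 0 := by
    intro h
    rw [nonempty_iso_bot_comap_iff]
    by_cases hi : Function.Injective h
    · have a := hi.ne (show (0 : Fin 3) ≠ 1 by decide)
      have b := hi.ne (show (0 : Fin 3) ≠ 2 by decide)
      have c := hi.ne (show (1 : Fin 3) ≠ 2 by decide)
      by_cases a' : G.Adj (h 0) (h 1) <;> by_cases b' : G.Adj (h 0) (h 2) <;>
        by_cases c' : G.Adj (h 1) (h 2) <;>
        simp [anticliqueWeight, closedAdj, hi, a, b, c, a', b', c']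
    · have : h 0 = h 1 ∨ h 0 = h 2 ∨ h 1 = h 2 := by
        by_contra! hne
        exact hi (injective_fin_three hne.1 hne.2.1 hne.2.2)
      rcases this with e | e | e <;> simp [anticliqueWeight, e, closedAdj_self, hi]
  simp only [this]
  exact expect_copy_bounds ⊥ G hV

theorem clique_bounds {V : Type*} [Fintype V] (G : SimpleGraph V) (hV : 3 ≤ Fintype.card V) :
    𝔼 h, cliqueWeight (closedAdj G) h ≤
        inducedDensity (⊤ : SimpleGraph (Fin 3)) G + 9 / Fintype.card V ∧
      inducedDensity (⊤ : SimpleGraph (Fin 3)) G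
        ≤ 𝔼 h, cliqueWeight (closedAdj G) h + 3 / Fintype.card V := by
  classical
  have hne : Nonempty V := Fintype.card_pos_iff.1 (by omega)
  obtain ⟨hl, hu⟩ := expect_copy_bounds ⊤ G hV
  have h0 : ∀ x y, 0 ≤ closedAdj G x y := fun x y => by
    rcases closedAdj_eq_zero_or_one G x y with h | h <;> rw [h]; norm_num
  have h1 : ∀ x y, closedAdj G x y ≤ 1 := fun x y => by
    rcases closedAdj_eq_zero_or_one G x y with h | h <;> rw [h]; norm_num
  constructor
  · have hinj : 𝔼 h : Fin 3 → V, (if Function.Injective h then (0 : ℝ) else 1)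
        ≤ 9 / Fintype.card V :=
      expect_not_injective_le.trans (le_of_eq (by rw [Fintype.card_fin]; norm_num))
    refine le_trans ?_ (add_le_add hl hinj)
    rw [← Finset.expect_add_distrib]
    refine Finset.expect_le_expect fun h _ => ?_
    rw [nonempty_iso_top_comap_iff]
    by_cases hi : Function.Injective h
    · have a := hi.ne (show (0 : Fin 3) ≠ 1 by decide)
      have b := hi.ne (show (0 : Fin 3) ≠ 2 by decide)
      have c := hi.ne (show (1 : Fin 3) ≠ 2 by decide)
      simp only [cliqueWeight, closedAdj, hi, a, b, c, false_or, true_and, if_true, add_zero]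
      split_ifs <;> simp_all
    · simp only [hi, false_and, if_false, zero_add]
      exact mul_le_one₀ (mul_le_one₀ (h1 _ _) (h0 _ _) (h1 _ _)) (h0 _ _) (h1 _ _)
  · refine hu.trans (add_le_add_left (Finset.expect_le_expect fun h _ => ?_) _)
    rw [nonempty_iso_top_comap_iff]
    split_ifs with hh
    · simp [cliqueWeight, closedAdj, hh.2]
    · exact mul_nonneg (mul_nonneg (h0 _ _) (h0 _ _)) (h0 _ _)

/-! ### Universality and the extremal sequence -/

/-- The finite form of universality: a large graph with few copies of some 3-vertex graph has
density at least `ρ - η` of empty triples or of triangles. -/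
theorem sub_le_max_inducedDensity_of_inducedDensity_lt {θ : ℝ}
    (hθ : θ ^ 3 + θ ^ 2 - θ + 1 / 6 = 0) (h1 : 0.4273725 < θ) (h2 : θ < 0.4273735)
    (H : SimpleGraph (Fin 3)) {η : ℝ} (hη : 0 < η) :
    ∃ ε > 0, ∃ N : ℕ, ∀ {V : Type*} [Fintype V] (G : SimpleGraph V), N ≤ Fintype.card V →
      inducedDensity H G < ε →
      6 * θ ^ 2 * (1 - 2 * θ) - η ≤ max (inducedDensity (⊥ : SimpleGraph (Fin 3)) G)
        (inducedDensity (⊤ : SimpleGraph (Fin 3)) G) := by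
  set ρ := 6 * θ ^ 2 * (1 - 2 * θ) with hρ
  have hρ' : ρ < 0.16 := by rw [hρ]; nlinarith
  have hgoodman : ∀ {V : Type _} [Fintype V] (G : SimpleGraph V), 900 ≤ Fintype.card V →
      0.24 ≤ inducedDensity (⊥ : SimpleGraph (Fin 3)) G
        + inducedDensity (⊤ : SimpleGraph (Fin 3)) G := by
    intro V _ G hV
    have hne : Nonempty V := Fintype.card_pos_iff.1 (by omega)
    have a := expect_cliqueWeight_add_anticliqueWeight (closedAdj_comm G)
    have b := (anticlique_bounds G (by omega)).1
    have c := (clique_bounds G (by omega)).1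
    have : (9 : ℝ) / Fintype.card V ≤ 0.01 := by
      have : (900 : ℝ) ≤ Fintype.card V := by exact_mod_cast hV
      rw [div_le_iff₀ (by linarith)]; linarith
    linarith
  by_cases hbot : H = ⊥
  · subst hbot
    refine ⟨0.08, by norm_num, 900, fun {V} _ G hV hlt => le_max_of_le_right ?_⟩
    linarith [hgoodman G hV]
  by_cases htop : H = ⊤
  · subst htop
    refine ⟨0.08, by norm_num, 900, fun {V} _ G hV hlt => le_max_of_le_left ?_⟩
    linarith [hgoodman G hV]
  obtain ⟨ε, hε, key⟩ := le_max_of_expect_cherryWeight_lt hθ h1 h2 (half_pos hη)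
  obtain ⟨N, hN⟩ := exists_nat_ge (18 / η)
  have main : ∀ K : SimpleGraph (Fin 3), (∃ σ : Equiv.Perm (Fin 3),
      K.Adj (σ 0) (σ 1) ∧ ¬ K.Adj (σ 0) (σ 2) ∧ K.Adj (σ 1) (σ 2)) →
      ∀ {V : Type _} [Fintype V] (G : SimpleGraph V), max 3 N ≤ Fintype.card V →
      inducedDensity K G < ε →
      ρ - η ≤ max (inducedDensity (⊥ : SimpleGraph (Fin 3)) G)
        (inducedDensity (⊤ : SimpleGraph (Fin 3)) G) := by
    rintro K ⟨σ, h01, h02, h12⟩ V _ G hV hlt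
    have hV3 : 3 ≤ Fintype.card V := (le_max_left _ _).trans hV
    have hne : Nonempty V := Fintype.card_pos_iff.1 (by omega)
    have hk := key G ((expect_cherryWeight_le h01 h02 h12 G hV3).trans_lt hlt)
    have b := (anticlique_bounds G hV3).1
    have c := (clique_bounds G hV3).1
    have : (9 : ℝ) / Fintype.card V ≤ η / 2 := by
      have h1 : (N : ℝ) ≤ Fintype.card V := by exact_mod_cast (le_max_right _ _).trans hV
      have h2 : (0 : ℝ) < Fintype.card V := by exact_mod_cast Fintype.card_pos
      have h3 := hN.trans h1
      rw [div_le_iff₀ hη] at h3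
      rw [div_le_iff₀ h2]; linarith
    rcases le_max_iff.1 hk with h | h
    · exact le_max_of_le_right (by linarith)
    · exact le_max_of_le_left (by linarith)
  refine ⟨ε, hε, max 3 N, fun {V} _ G hV hlt => ?_⟩
  rcases exists_perm_cherry H hbot htop with hσ | hσ
  · exact main H hσ G hV hlt
  · have := main Hᶜ hσ Gᶜ hV (by rwa [inducedDensity_compl])
    rw [max_comm, ← inducedDensity_compl ⊥ G, ← inducedDensity_compl ⊤ G]
    simpa using this

theorem GraphSeq.isUniversal_of_upperDensity_lt {θ : ℝ}
    (hθ : θ ^ 3 + θ ^ 2 - θ + 1 / 6 = 0) (h1 : 0.4273725 < θ) (h2 : θ < 0.4273735)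
    (𝒢 : GraphSeq)
    (hbot : upperDensity (⊥ : SimpleGraph (Fin 3)) 𝒢 < 6 * θ ^ 2 * (1 - 2 * θ))
    (htop : upperDensity (⊤ : SimpleGraph (Fin 3)) 𝒢 < 6 * θ ^ 2 * (1 - 2 * θ)) :
    𝒢.IsUniversal 3 := by
  intro H
  by_contra! hle
  have hbdd : ∀ K : SimpleGraph (Fin 3),
      atTop.IsBoundedUnder (· ≤ ·) fun n => inducedDensity K (𝒢.graph n) := fun K =>
    isBoundedUnder_of ⟨1, fun n => inducedDensity_le_one _ _⟩
  have hbdd' : atTop.IsBoundedUnder (· ≥ ·) fun n => inducedDensity H (𝒢.graph n) :=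
    isBoundedUnder_of ⟨0, fun n => inducedDensity_nonneg _ _⟩
  obtain ⟨x, hx, hxρ⟩ := exists_between (max_lt hbot htop)
  obtain ⟨ε, hε, N, key⟩ :=
    sub_le_max_inducedDensity_of_inducedDensity_lt hθ h1 h2 H (sub_pos.2 hxρ)
  have f1 : ∃ᶠ n in atTop, inducedDensity H (𝒢.graph n) < ε :=
    frequently_lt_of_liminf_lt (hbdd H).isCobounded_ge (hle.trans_lt hε)
  have f2 := eventually_lt_of_limsup_lt ((le_max_left _ _).trans_lt hx) (hbdd ⊥)
  have f3 := eventually_lt_of_limsup_lt ((le_max_right _ _).trans_lt hx) (hbdd ⊤)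
  obtain ⟨n, a, b, c, d⟩ :=
    (f1.and_eventually (f2.and (f3.and (𝒢.tendsto_card.eventually_ge_atTop N)))).exists
  have := key (𝒢.graph n) d a
  linarith [max_lt b c]

/-- The disjoint union of the complete graphs on the sets `V i`. -/
def clusterGraph {ι : Type*} (V : ι → Type*) : SimpleGraph (Σ i, V i) :=
  (SimpleGraph.completeMultipartiteGraph V)ᶜ

theorem clusterGraph_adj {ι : Type*} {V : ι → Type*} {x y : Σ i, V i} :
    (clusterGraph V).Adj x y ↔ x ≠ y ∧ x.1 = y.1 := by
  simp [clusterGraph, SimpleGraph.compl_adj]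

theorem closedAdj_clusterGraph {ι : Type*} [DecidableEq ι] (V : ι → Type*) :
    closedAdj (clusterGraph V) = fun x y => if x.1 = y.1 then (1 : ℝ) else 0 := by
  ext x y
  have hiff : (x = y ∨ (clusterGraph V).Adj x y) ↔ x.1 = y.1 := by
    rw [clusterGraph_adj]
    exact ⟨fun h => h.elim (fun h => h ▸ rfl) And.right,
      fun h => or_iff_not_imp_left.2 fun h' => ⟨h', h⟩⟩
  by_cases hxy : x.1 = y.1 <;> simp only [closedAdj, hiff, hxy, if_true, if_false]

theorem partSize_sigma_fst {ι : Type*} [Fintype ι] [DecidableEq ι] (k : ι → ℕ) (i : ι) :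
    partSize (Sigma.fst : (Σ i, Fin (k i)) → ι) i = k i / (∑ j, k j : ℕ) := by
  unfold partSize
  rw [Fintype.expect_eq_sum_div_card, Fintype.sum_sigma,
    Finset.sum_eq_single i (fun j _ hj => by simp [hj]) (by simp)]
  simp

/-- The clique sizes `⌊θ n⌋, ⌊θ n⌋, n - 2 ⌊θ n⌋` of the extremal graph on `n` vertices. -/
noncomputable def extremalSizes (θ : ℝ) (n : ℕ) : Fin 3 → ℕ :=
  ![⌊θ * n⌋₊, ⌊θ * n⌋₊, n - 2 * ⌊θ * n⌋₊]

theorem two_mul_floor_le {θ : ℝ} (h0 : 0 < θ) (h : θ < 1 / 2) (n : ℕ) : 2 * ⌊θ * n⌋₊ ≤ n := by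
  have h1 : (⌊θ * n⌋₊ : ℝ) ≤ θ * n := Nat.floor_le (by positivity)
  have h2 : (2 * ⌊θ * n⌋₊ : ℝ) ≤ n := by nlinarith [(Nat.cast_nonneg n : (0 : ℝ) ≤ n)]
  exact_mod_cast h2

theorem sum_extremalSizes {θ : ℝ} (h0 : 0 < θ) (h : θ < 1 / 2) (n : ℕ) :
    ∑ i, extremalSizes θ n i = n := by
  have := two_mul_floor_le h0 h n
  simp only [extremalSizes, Fin.sum_univ_three, Matrix.cons_val_zero, Matrix.cons_val_one,
    Matrix.cons_val]
  omega

/-- The disjoint unions of three cliques with vertex fractions tending to `θ`, `θ` and `1 - 2θ`. -/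
noncomputable def extremalSeq {θ : ℝ} (h0 : 0 < θ) (h : θ < 1 / 2) : GraphSeq.{0} where
  V n := Σ i, Fin (extremalSizes θ n i)
  graph n := clusterGraph _
  tendsto_card := by
    simp only [Fintype.card_sigma, Fintype.card_fin, sum_extremalSizes h0 h]
    exact tendsto_id

theorem tendsto_extremalSizes_div {θ : ℝ} (h0 : 0 < θ) (h : θ < 1 / 2) (i : Fin 3) :
    Tendsto (fun n => (extremalSizes θ n i : ℝ) / n) atTop (𝓝 (![θ, θ, 1 - 2 * θ] i)) := by
  have hf : Tendsto (fun n : ℕ => (⌊θ * n⌋₊ : ℝ) / n) atTop (𝓝 θ) :=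
    (tendsto_nat_floor_mul_div_atTop h0.le).comp tendsto_natCast_atTop_atTop
  fin_cases i
  · exact hf
  · exact hf
  · refine Tendsto.congr' ?_ (tendsto_const_nhds.sub (hf.const_mul 2))
    filter_upwards [eventually_gt_atTop 0] with n hn
    have hn' : (n : ℝ) ≠ 0 := by positivity
    simp only [extremalSizes, Fin.reduceFinMk, Matrix.cons_val]
    rw [Nat.cast_sub (two_mul_floor_le h0 h n)]
    push_cast
    field_simp

theorem extremalSeq_upperDensity {θ : ℝ} (h0 : 0 < θ) (h : θ < 1 / 2) :
    GraphSeq.upperDensity (⊥ : SimpleGraph (Fin 3)) (extremalSeq h0 h) = 6 * θ ^ 2 * (1 - 2 * θ) ∧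
    GraphSeq.upperDensity (⊤ : SimpleGraph (Fin 3)) (extremalSeq h0 h)
      = 2 * θ ^ 3 + (1 - 2 * θ) ^ 3 := by
  set 𝒢 := extremalSeq h0 h with h𝒢
  have hcard : ∀ n, Fintype.card (𝒢.V n) = n := fun n => by
    simp [h𝒢, extremalSeq, sum_extremalSizes h0 h]
  have hclosed : ∀ n, closedAdj (𝒢.graph n) = fun x y => if x.1 = y.1 then (1 : ℝ) else 0 :=
    fun n => closedAdj_clusterGraph _
  have hpow : ∀ p : ℕ, Tendsto
      (fun n => ∑ i, partSize (Sigma.fst : 𝒢.V n → Fin 3) i ^ p) atTop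
      (𝓝 (2 * θ ^ p + (1 - 2 * θ) ^ p)) := by
    intro p
    have := tendsto_finsetSum Finset.univ fun i _ => (tendsto_extremalSizes_div h0 h i).pow p
    simp only [Fin.sum_univ_three (f := fun i : Fin 3 => ![θ, θ, 1 - 2 * θ] i ^ p)] at this
    convert this using 2 with n
    · refine Finset.sum_congr rfl fun i _ => ?_
      have := partSize_sigma_fst (extremalSizes θ n) i
      rw [sum_extremalSizes h0 h] at this
      exact congrArg (· ^ p) this
    · simp; ring
  have hC : Tendsto (fun n => 𝔼 h, cliqueWeight (closedAdj (𝒢.graph n)) h) atTop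
      (𝓝 (2 * θ ^ 3 + (1 - 2 * θ) ^ 3)) := by
    refine (hpow 3).congr fun n => ?_
    rw [hclosed, expect_cliqueWeight_partition]
    rfl
  have hA : Tendsto (fun n => 𝔼 h, anticliqueWeight (closedAdj (𝒢.graph n)) h) atTop
      (𝓝 (6 * θ ^ 2 * (1 - 2 * θ))) := by
    have e : 6 * θ ^ 2 * (1 - 2 * θ) = 1 - 3 * (2 * θ ^ 2 + (1 - 2 * θ) ^ 2)
      + 2 * (2 * θ ^ 3 + (1 - 2 * θ) ^ 3) := by ring
    rw [e]
    refine ((tendsto_const_nhds.sub ((hpow 2).const_mul 3)).add ((hpow 3).const_mul 2)).congr' ?_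
    filter_upwards [eventually_gt_atTop 0] with n hn
    have : Nonempty (𝒢.V n) := Fintype.card_pos_iff.1 (by rw [hcard]; exact hn)
    rw [hclosed, expect_anticliqueWeight_partition]
    rfl
  have hsmall : ∀ C : ℝ, Tendsto (fun n => C / Fintype.card (𝒢.V n)) atTop (𝓝 0) := fun C => by
    simp only [hcard]
    exact tendsto_const_div_atTop_nhds_zero_nat C
  have hlarge : ∀ᶠ n in atTop, 3 ≤ Fintype.card (𝒢.V n) := by
    simp only [hcard]; exact eventually_ge_atTop 3
  constructor
  · refine Tendsto.limsup_eq ?_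
    refine tendsto_of_tendsto_of_tendsto_of_le_of_le' hA (by simpa using hA.add (hsmall 3)) ?_ ?_
    · filter_upwards [hlarge] with n hn using (anticlique_bounds _ hn).1
    · filter_upwards [hlarge] with n hn using (anticlique_bounds _ hn).2
  · refine Tendsto.limsup_eq ?_
    refine tendsto_of_tendsto_of_tendsto_of_le_of_le' (by simpa using hC.sub (hsmall 9))
      (by simpa using hC.add (hsmall 3)) ?_ ?_
    · filter_upwards [hlarge] with n hn using sub_le_iff_le_add.2 (clique_bounds _ hn).1
    · filter_upwards [hlarge] with n hn using (clique_bounds _ hn).2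

theorem extremalSeq_not_isUniversal {θ : ℝ} (h0 : 0 < θ) (h : θ < 1 / 2) :
    ¬ (extremalSeq h0 h).IsUniversal 3 := by
  intro hu
  let P : SimpleGraph (Fin 3) := SimpleGraph.pathGraph 3
  have hzero : ∀ n, inducedDensity P ((extremalSeq h0 h).graph n) = 0 := by
    intro n
    have hfree : ∀ s : Finset ((extremalSeq h0 h).V n),
        Nonempty (P ≃g ((extremalSeq h0 h).graph n).induce (s : Set _)) ↔ False := by
      refine fun s => iff_false_intro ?_
      rintro ⟨f⟩
      have h01 : P.Adj 0 1 := by simp [P, SimpleGraph.pathGraph_adj]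
      have h12 : P.Adj 1 2 := by simp [P, SimpleGraph.pathGraph_adj]
      have h02 : ¬ P.Adj 0 2 := by simp [P, SimpleGraph.pathGraph_adj]
      have e01 := (clusterGraph_adj.1 (f.map_adj_iff.2 h01)).2
      have e12 := (clusterGraph_adj.1 (f.map_adj_iff.2 h12)).2
      refine h02 (f.map_adj_iff.1 (clusterGraph_adj.2 ⟨fun e => ?_, e01.trans e12⟩))
      exact absurd (f.injective (Subtype.val_injective e)) (by decide)
    simp [inducedDensity, hfree]
  have := hu P
  simp [GraphSeq.lowerDensity, hzero] at this

theorem theorem2 :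
    ∃ θ ρ : ℝ,
      IsGreatest {x : ℝ | x ^ 3 + x ^ 2 - x + 1 / 6 = 0} θ ∧
      ρ = 6 * θ ^ 2 * (1 - 2 * θ) ∧
      |θ - 0.427373| < 0.0000005 ∧
      (0.159181 ≤ ρ ∧ ρ < 0.159182) ∧
      (∀ 𝒢 : GraphSeq.{u},
        GraphSeq.upperDensity (⊥ : SimpleGraph (Fin 3)) 𝒢 < ρ →
        GraphSeq.upperDensity (⊤ : SimpleGraph (Fin 3)) 𝒢 < ρ →
        GraphSeq.IsUniversal 3 𝒢) ∧
      (∃ 𝒢 : GraphSeq.{0},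
        GraphSeq.upperDensity (⊥ : SimpleGraph (Fin 3)) 𝒢 = ρ ∧
        GraphSeq.upperDensity (⊤ : SimpleGraph (Fin 3)) 𝒢 = ρ ∧
        ¬ GraphSeq.IsUniversal 3 𝒢) := by
  obtain ⟨θ, hgr, h1, h2⟩ := cubic_root_isGreatest
  have hθ : θ ^ 3 + θ ^ 2 - θ + 1 / 6 = 0 := hgr.1
  refine ⟨θ, 6 * θ ^ 2 * (1 - 2 * θ), hgr, rfl, abs_lt.2 ⟨by linarith, by linarith⟩, ?_,
    fun 𝒢 hb ht => GraphSeq.isUniversal_of_upperDensity_lt hθ h1 h2 𝒢 hb ht, ?_⟩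
  · have e : 6 * θ ^ 2 * (1 - 2 * θ) = 18 * θ ^ 2 - 12 * θ + 2 := by linear_combination (-12) * hθ
    rw [e]
    constructor <;> nlinarith
  · obtain ⟨hb, ht⟩ := extremalSeq_upperDensity (θ := θ) (by linarith) (by linarith)
    refine ⟨_, hb, ht.trans ?_, extremalSeq_not_isUniversal _ _⟩
    linear_combination 6 * hθ
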